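/- Let $\Sigma$ be a finite totally ordered alphabet of size $\sigma$ and let $T, P \in \Sigma^*$. For a string $U$ let $\mathsf{slink}(U)$ be $U$ without its first symbol. The linear-size suffix trie $\mathsf{LST}(T)$ has as nodes the type-1 nodes, i.e. the substrings $U$ of $T$ that are suffixes of $T$ (in particular the root $\varepsilon$) or for which $Ua$ and $Ub$ occur in $T$ for two distinct symbols $a,b$, and the type-2 nodes, i.e. the other substrings $U$ of $T$ for which $\mathsf{slink}(U)$ is a type-1 node. The parent of a node $V\neq\varepsilon$ is its longest proper prefix $U$ that is a node; the edge $(U,V)$ stores only the single symbol that follows $U$ in $V$, and $V$ stores a flag $\mathsf{+}$ that says whether $|V|-|U|\ge 2$. The fast link of an edge $(U,V)$ is $(\mathsf{slink}^h(U),\mathsf{slink}^h(V))$ for the least $h \le |U|$ such that $\mathsf{slink}^h(U)$ is not the parent of $\mathsf{slink}^h(V)$, if such an $h$ exists. There is an algorithm which, given $\mathsf{LST}(T)$ with its fast links (but not $T$) and the pattern $P$, finds the longest prefix $P'$ of $P$ that occurs in $T$ (it outputs $|P'|$) in $O\big((|P'|+1)(\log\sigma+1)\big)$ time; that is, in $O(|P'|\log\sigma)$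 time if $|P'|\ge 1$ and $\sigma\ge 2$. The algorithm is one program, and the constant one number, for all $\Sigma$, $T$ and $P$. The model is a unit-cost random access machine, on which symbols can only be copied and compared, whose words hold numbers up to a constant multiple of the memory size of the input; the outgoing edges of each node are given in a table sorted by edge label. -/

import Mathlib

/-! Linear-size suffix tries (LSTs) with fast links, the random access machine on which
running times are measured, and the way an LST is given to such a machine.
Strings over an alphabet `α` are lists; a node is identified with its path label;
`U <+: V`, `U <:+ V`, `U <:+: V` say that `U` is a prefix, suffix, substring of `V`. -/

namespace LST

variable {α : Type*}

/-- The suffix link: delete the first symbol. -/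
def slink (U : List α) : List α := U.tail

/-- `U` is a type-1 node of the LST of `T`, that is, an explicit node of the suffix tree of `T`
in which every suffix of `T` (in particular the empty one, the root) is explicit:
`U` is a suffix of `T`, or it is followed by two distinct symbols in `T`. -/
def IsType1 (T U : List α) : Prop :=
  U <:+ T ∨ ∃ a b : α, a ≠ b ∧ (U ++ [a]) <:+: T ∧ (U ++ [b]) <:+: T

/-- `U` is a type-2 node: a substring of `T` that is not a type-1 node and
whose suffix link points to a type-1 node. -/
def IsType2 (T U : List α) : Prop :=
  U <:+: T ∧ ¬ IsType1 T U ∧ IsType1 T (slink U)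

/-- `U` is a node of the LST of `T`. -/
def IsNode (T U : List α) : Prop := IsType1 T U ∨ IsType2 T U

/-- `U` is the parent of `V` in the LST of `T`, that is, `(U, V)` is an edge. -/
def IsParent (T U V : List α) : Prop :=
  IsNode T U ∧ IsNode T V ∧ U <+: V ∧ U ≠ V ∧
    ∀ W : List α, IsNode T W → U <+: W → W <+: V → W = U ∨ W = V

/-- `(U, V)` is an edge with label `c`, that is, `V = child(U, c)`. The edge label is
the first symbol on the path from `U` to `V` in the suffix trie. -/
def IsChild (T U : List α) (c : α) (V : List α) : Prop :=
  IsParent T U V ∧ (U ++ [c]) <+: V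

/-- `V` is a `+`-node: the path from its parent to it in the suffix trie has length at least 2. -/
def IsPlus (T V : List α) : Prop :=
  ∃ U : List α, IsParent T U V ∧ U.length + 2 ≤ V.length

/-- `fastLink(U, V) = (slink^h(U), slink^h(V))`, i.e. `h` is the least number of suffix links that
take `U` and `V` to nodes of which the first is not the parent of the second.
(`h ≤ |U|`, as the root has no suffix link within the tree.) -/
def IsFastLinkHeight (T U V : List α) (h : ℕ) : Prop :=
  h ≤ U.length ∧ ¬ IsParent T (slink^[h] U) (slink^[h] V) ∧
    ∀ i < h, IsParent T (slink^[i] U) (slink^[i] V)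

/-- `P'` is the longest prefix of `P` that occurs in `T`. -/
def IsLongestPrefix (T P P' : List α) : Prop :=
  P' <+: P ∧ P' <:+: T ∧ ∀ Q : List α, Q <+: P → Q <:+: T → Q.length ≤ P'.length

end LST

namespace RAM

/-- A machine word holds a natural number or a symbol of the alphabet.
Programs can copy symbols and compare them, nothing else. -/
inductive Word (α : Type*) where
  | num (n : ℕ) : Word α
  | sym (c : α) : Word α
  deriving DecidableEq

/-- Instructions; the arguments `d a b s` are names of registers, `l` is a position in the program,
`n` is a constant. Instructions do not mention the alphabet. -/
inductive Instr where
  /-- `R[d] := n` -/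
  | const (d n : ℕ)
  /-- `R[d] := R[s]` -/
  | move (d s : ℕ)
  /-- `R[d] := R[a] + R[b]` -/
  | add (d a b : ℕ)
  /-- `R[d] := max (R[a] - R[b]) 0` -/
  | sub (d a b : ℕ)
  /-- `R[d] := ⌊R[a] / 2⌋` -/
  | half (d a : ℕ)
  /-- `R[d] := M[R[a]]` -/
  | load (d a : ℕ)
  /-- `M[R[a]] := R[s]` -/
  | store (a s : ℕ)
  /-- go to `l` -/
  | jump (l : ℕ)
  /-- if `R[a] = R[b]` then go to `l` -/
  | jumpEq (a b l : ℕ)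
  /-- if `R[a] < R[b]` then go to `l` -/
  | jumpLt (a b l : ℕ)
  /-- stop -/
  | halt

/-- A program is a finite list of instructions. -/
abbrev Program := List Instr

/-- A configuration: program counter, registers, memory. -/
structure Config (α : Type*) where
  pc : ℕ
  reg : ℕ → Word α
  mem : ℕ → Word α

variable {α : Type*}

/-- Write a word to register `d` and go to the next instruction. -/
def Config.set (x : Config α) (d : ℕ) (w : Word α) : Config α :=
  { x with pc := x.pc + 1, reg := Function.update x.reg d w }

/-- Go to `l` if `b` holds, otherwise to the next instruction. -/
def Config.branch (x : Config α) (b : Bool) (l : ℕ) : Config α :=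
  { x with pc := if b then l else x.pc + 1 }

variable [LinearOrder α]

/-- The effect of one instruction on a machine whose words hold numbers up to `W`.
The value `none` is a fault: an overflow, arithmetic on symbols, a symbol used as an address,
a number compared with a symbol for order. -/
def Instr.exec (W : ℕ) (x : Config α) : Instr → Option (Config α)
  | .const d n => if n ≤ W then some (x.set d (.num n)) else none
  | .move d s => some (x.set d (x.reg s))
  | .add d a b =>
    match x.reg a, x.reg b with
    | .num m, .num n => if m + n ≤ W then some (x.set d (.num (m + n))) else none
    | _, _ => none
  | .sub d a b =>
    match x.reg a, x.reg b with
    | .num m, .num n => some (x.set d (.num (m - n)))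
    | _, _ => none
  | .half d a =>
    match x.reg a with
    | .num m => some (x.set d (.num (m / 2)))
    | _ => none
  | .load d a =>
    match x.reg a with
    | .num m => some (x.set d (x.mem m))
    | _ => none
  | .store a s =>
    match x.reg a with
    | .num m => some { x with pc := x.pc + 1, mem := Function.update x.mem m (x.reg s) }
    | _ => none
  | .jump l => some (x.branch true l)
  | .jumpEq a b l => some (x.branch (decide (x.reg a = x.reg b)) l)
  | .jumpLt a b l =>
    match x.reg a, x.reg b with
    | .num m, .num n => some (x.branch (decide (m < n)) l)
    | .sym c, .sym e => some (x.branch (decide (c < e)) l)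
    | _, _ => none
  | .halt => none

/-- One step of a program. -/
def step (W : ℕ) (prog : Program) (x : Config α) : Option (Config α) :=
  (prog[x.pc]?).bind fun i => i.exec W x

/-- `t` steps of a program. -/
def run (W : ℕ) (prog : Program) : ℕ → Config α → Option (Config α)
  | 0, x => some x
  | t + 1, x => (step W prog x).bind (run W prog t)

/-- Started in `x`, the program executes at most `B` unit-cost instructions without a fault,
arrives at a `halt` instruction, and then register `0` holds the number `k`. -/
def HaltsWithin (W : ℕ) (prog : Program) (x : Config α) (B k : ℕ) : Prop :=
  ∃ t ≤ B, ∃ y : Config α, run W prog t x = some y ∧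
    prog[y.pc]? = some Instr.halt ∧ y.reg 0 = Word.num k

end RAM

namespace LST

open RAM

variable {α : Type*} [LinearOrder α]

/-- Where the parts of an LST are placed in memory: the address of the record of each node, the
address of the table of its outgoing edges, and the entries of that table. -/
structure Layout (α : Type*) where
  addr : List α → ℕ
  table : List α → ℕ
  kids : List α → List (α × List α)

/-- The cells below `free` of the memory `mem` hold the LST of `T` with its fast links, placed
according to `L`.
* Different nodes have different addresses.
* The record of a node `U` has 4 cells: the `+`-flag, the suffix link (if `U` is not the root),
  the number of children, and the address of the table of the outgoing edges.
* That table lists the outgoing edges `(U, V)` by increasing label. An entry has 4 cells: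
  the label, the address of `V`, and, if `(U, V)` has a fast link `(U', V')`,
  the addresses of `U'` and `V'`. -/
structure Stores (T : List α) (mem : ℕ → Word α) (free : ℕ) (L : Layout α) : Prop where
  addr_inj : ∀ U V : List α, IsNode T U → IsNode T V → L.addr U = L.addr V → U = V
  addr_lt : ∀ U : List α, IsNode T U → L.addr U + 4 ≤ free
  plus_true : ∀ U : List α, IsNode T U → IsPlus T U → mem (L.addr U) = .num 1
  plus_false : ∀ U : List α, IsNode T U → ¬ IsPlus T U → mem (L.addr U) = .num 0
  suffix_link : ∀ U : List α, IsNode T U → U ≠ [] →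
    mem (L.addr U + 1) = .num (L.addr (slink U))
  kids_sorted : ∀ U : List α, IsNode T U → (L.kids U).Pairwise fun x y => x.1 < y.1
  mem_kids : ∀ U : List α, IsNode T U →
    ∀ (c : α) (V : List α), (c, V) ∈ L.kids U ↔ IsChild T U c V
  kids_length : ∀ U : List α, IsNode T U → mem (L.addr U + 2) = .num (L.kids U).length
  table_addr : ∀ U : List α, IsNode T U → mem (L.addr U + 3) = .num (L.table U)
  table_le : ∀ U : List α, IsNode T U → L.table U + 4 * (L.kids U).length ≤ free
  edge_label : ∀ U : List α, IsNode T U → ∀ (j : ℕ) (c : α) (V : List α),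
    (L.kids U)[j]? = some (c, V) → mem (L.table U + 4 * j) = .sym c
  edge_target : ∀ U : List α, IsNode T U → ∀ (j : ℕ) (c : α) (V : List α),
    (L.kids U)[j]? = some (c, V) → mem (L.table U + 4 * j + 1) = .num (L.addr V)
  fast_link : ∀ U : List α, IsNode T U → ∀ (j : ℕ) (c : α) (V : List α),
    (L.kids U)[j]? = some (c, V) → ∀ h : ℕ, IsFastLinkHeight T U V h →
      mem (L.table U + 4 * j + 2) = .num (L.addr (slink^[h] U)) ∧
      mem (L.table U + 4 * j + 3) = .num (L.addr (slink^[h] V))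

/-- The string `P` is stored at address `p`, below `free`. -/
def StoresString (P : List α) (mem : ℕ → Word α) (free p : ℕ) : Prop :=
  p + P.length ≤ free ∧ ∀ (i : ℕ) (c : α), P[i]? = some c → mem (p + i) = .sym c

/-- The input of pattern matching: register `0` holds the address of the root of an LST with fast
links, registers `1` and `2` the address and the length of the pattern, register `3` the
address from which on the memory may be used as work space. All else is arbitrary. -/
def IsMatchingInput (T P : List α) (L : Layout α) (free p : ℕ) (x : Config α) : Prop :=
  Stores T x.mem free L ∧ StoresString P x.mem free p ∧ x.pc = 0 ∧
    x.reg 0 = .num (L.addr []) ∧ x.reg 1 = .num p ∧ x.reg 2 = .num P.length ∧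
    x.reg 3 = .num free

end LST

/-! An edge `(X, X ++ w)` stores only the first symbol of `w`; the rest is recovered through its
fast link of height `h`. A type-1 node strictly inside the path from `slink^h X` to `slink^h (X ++
w)` would turn the string one suffix link earlier into a node inside the edge at height `h - 1`,
which is impossible. So the inner nodes of that path do not branch, and a walk along it guided by
the pattern either spells `w` or stops at the first mismatch. The upper end of the path may branch,
but there the next symbol of the pattern is already known to match. Long edges met on the way are
treated recursively, with a stack of places to return to.

The path of a fast link has at least two edges, so the decompaction of an edge is a tree with `|w|`
leaves whose inner vertices have at least two children: `|w|` symbols read, at most `|w| - 1` pushes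
and as many pops, at most `3|w| - 2` steps. If the run fails, the pushes that were not undone are
paid by the depth of the current node: a push lowers it by `h > 0`, a symbol read raises it by one.
Hence at most `4r + |X|` steps when `r` symbols of `w` match, and at most `4|P'|` steps overall.

`IsFastLinkHeight.not_isType1` gives the combinatorics, `traverses_edge` and
`exists_matchSteps_isFinal` the step count. `Represents.ensures_step` simulates one step on the
machine at the price of one binary search among at most `σ` edges. -/

namespace LST

/-! ### Nodes, edges and fast links of the linear-size suffix trie. -/

section Combinatorics

variable {α : Type*} {T U V W X Y Z : List α}

theorem iterate_slink (h : ℕ) (U : List α) : slink^[h] U = U.drop h := by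
  induction h generalizing U with
  | zero => simp
  | succ h ih => rw [Function.iterate_succ_apply, ih, slink, List.drop_tail]

theorem IsType1.isInfix (h : IsType1 T U) : U <:+: T := by
  rcases h with h | ⟨a, _, _, h, _⟩
  · exact h.isInfix
  · exact (List.prefix_append U [a]).isInfix.trans h

theorem IsNode.isInfix (h : IsNode T U) : U <:+: T :=
  h.elim IsType1.isInfix fun h => h.1

theorem slink_append_isSuffix (U V : List α) : slink U ++ V <:+ U ++ V := by
  cases U with
  | nil => simp [slink]
  | cons x U => simp [slink]

theorem IsType1.slink (h : IsType1 T U) : IsType1 T (slink U) := by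
  rcases h with h | ⟨a, b, hab, ha, hb⟩
  · exact .inl ((List.tail_suffix U).trans h)
  · exact .inr ⟨a, b, hab, (slink_append_isSuffix U [a]).isInfix.trans ha,
      (slink_append_isSuffix U [b]).isInfix.trans hb⟩

theorem IsNode.slink_isType1 (h : IsNode T U) : IsType1 T (slink U) :=
  h.elim IsType1.slink fun h => h.2.2

/-- Type-2 nodes exist for this closure property: nodes pull back along suffix links from type-1
nodes. -/
theorem isNode_of_slink (hU : U <:+: T) (h : IsType1 T (slink U)) : IsNode T U := by
  by_cases h1 : IsType1 T U
  · exact .inl h1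
  · exact .inr ⟨hU, h1, h⟩

theorem IsNode.drop (h : IsNode T U) (k : ℕ) : IsNode T (U.drop k) := by
  induction k with
  | zero => simpa
  | succ k ih =>
    have := ih.slink_isType1
    rw [LST.slink, List.tail_drop] at this
    exact .inl this

theorem isNode_nil : IsNode T [] := .inl (.inl (List.nil_suffix))

theorem eq_of_not_isType1 {a b : α} (h : ¬ IsType1 T U) (ha : U ++ [a] <:+: T)
    (hb : U ++ [b] <:+: T) : a = b := by
  by_contra hab
  exact h (.inr ⟨a, b, hab, ha, hb⟩)

/-- Between a node and a proper descendant there is a child of the node. -/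
theorem exists_isParent_toward (hX : IsNode T X) (hY : IsNode T Y) (hXY : X <+: Y)
    (hne : X ≠ Y) : ∃ W, IsParent T X W ∧ W <+: Y := by
  classical
  have hlt : X.length < Y.length :=
    lt_of_le_of_ne hXY.length_le fun h => hne (hXY.eq_of_length h)
  -- The child is the shortest prefix of `Y` that is a node and longer than `X`.
  have hex : ∃ k, X.length < k ∧ k ≤ Y.length ∧ IsNode T (Y.take k) :=
    ⟨Y.length, hlt, le_rfl, by simpa⟩
  obtain ⟨h1, h2, h3⟩ := Nat.find_spec hex
  set k := Nat.find hex with hk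
  have hlen : (Y.take k).length = k := by simp [h2]
  refine ⟨Y.take k, ⟨hX, h3, ?_, ?_, ?_⟩, List.take_prefix _ _⟩
  · exact List.prefix_of_prefix_length_le hXY (List.take_prefix _ _) (by omega)
  · intro h
    rw [← h] at hlen
    omega
  · intro Z hZ hXZ hZW
    by_cases hZX : Z = X
    · exact .inl hZX
    · right
      have hl : X.length < Z.length :=
        lt_of_le_of_ne hXZ.length_le fun h => hZX (hXZ.eq_of_length h).symm
      have hZY := hZW.trans (List.take_prefix k Y)
      have : k ≤ Z.length := by
        refine Nat.find_min' hex ⟨hl, hZY.length_le, ?_⟩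
        rwa [← List.prefix_iff_eq_take.1 hZY]
      exact hZW.eq_of_length (by have := hZW.length_le; omega)

theorem IsParent.unique (h : IsParent T U V) (h' : IsParent T W V) : U = W := by
  rcases List.prefix_or_prefix_of_prefix h.2.2.1 h'.2.2.1 with hp | hp
  · exact ((h.2.2.2.2 W h'.1 hp h'.2.2.1).resolve_right h'.2.2.2.1).symm
  · exact (h'.2.2.2.2 U h.1 hp h.2.2.1).resolve_right h.2.2.2.1

theorem IsParent.isPlus_iff (h : IsParent T U V) : IsPlus T V ↔ U.length + 2 ≤ V.length :=
  ⟨fun ⟨_, hW, hl⟩ => h.unique hW ▸ hl, fun hl => ⟨U, h, hl⟩⟩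

/-- At the latest the search for a height ends at the root: a single symbol has the root as suffix
link, hence is a node, so no edge leaving the root has length 2 or more. -/
theorem exists_isFastLinkHeight (hl : X.length + 2 ≤ Y.length) :
    ∃ h, IsFastLinkHeight T X Y h := by
  classical
  have hroot : ¬ IsParent T (slink^[X.length] X) (slink^[X.length] Y) := by
    rw [iterate_slink, iterate_slink, List.drop_length]
    intro h
    have hlen : 2 ≤ (Y.drop X.length).length := by simp; omega
    rcases hd : Y.drop X.length with _ | ⟨a, Y'⟩
    · simp [hd] at hlen
    rw [hd] at h hlen
    have hpre : [a] <+: a :: Y' := by simp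
    have hn : IsNode T [a] :=
      isNode_of_slink (hpre.isInfix.trans h.2.1.isInfix) (.inl List.nil_suffix)
    rcases h.2.2.2.2 [a] hn List.nil_prefix hpre with h | h
    · simp at h
    · simp [← List.cons.inj h] at hlen
  have hex : ∃ h, ¬ IsParent T (slink^[h] X) (slink^[h] Y) := ⟨_, hroot⟩
  exact ⟨Nat.find hex, Nat.find_min' hex hroot, Nat.find_spec hex,
    fun i hi => not_not.1 (Nat.find_min hex hi)⟩

theorem IsFastLinkHeight.pos {h : ℕ} (hp : IsParent T X Y) (hh : IsFastLinkHeight T X Y h) :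
    0 < h := by
  rcases Nat.eq_zero_or_pos h with rfl | h0
  · exact absurd hp hh.2.1
  · exact h0

/-- The nodes strictly between the two ends of a fast link are not of type 1. -/
theorem IsFastLinkHeight.not_isType1 {h j : ℕ} {w : List α}
    (hp : IsParent T X (X ++ w)) (hh : IsFastLinkHeight T X (X ++ w) h) (hj : 0 < j) (hjw : j < w.length) :
    ¬ IsType1 T (X.drop h ++ w.take j) := by
  intro h1
  have h0 := hh.pos hp
  obtain ⟨k, rfl⟩ : ∃ k, h = k + 1 := ⟨h - 1, by omega⟩
  have hpk := hh.2.2 k (Nat.lt_succ_self k)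
  have hkX : k < X.length := hh.1
  rw [iterate_slink, iterate_slink, List.drop_append_of_le_length hkX.le] at hpk
  have hpre : X.drop k ++ w.take j <+: X.drop k ++ w :=
    (List.prefix_append_right_inj _).2 (List.take_prefix _ _)
  -- One suffix link earlier, a type-1 node gives a node strictly inside an edge.
  have hn : IsNode T (X.drop k ++ w.take j) := by
    refine isNode_of_slink (hpre.isInfix.trans hpk.2.1.isInfix) ?_
    have : slink (X.drop k ++ w.take j) = X.drop (k + 1) ++ w.take j := by
      rw [slink, List.tail_append_of_ne_nil (by simp; omega), List.tail_drop]
    rwa [this]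
  rcases hpk.2.2.2.2 _ hn (List.prefix_append _ _) hpre with h | h
  · have := congrArg List.length h
    rw [List.length_append, List.length_take] at this
    omega
  · have := congrArg List.length h
    rw [List.length_append, List.length_append, List.length_take] at this
    omega

/-- The suffix of `T` that starts at an occurrence of `X ++ [c]` is a node; the child of `X` towards
it has label `c`. -/
theorem exists_isChild_of_append_isInfix {c : α} (hX : IsNode T X) (h : X ++ [c] <:+: T) :
    ∃ Y, IsChild T X c Y := by
  obtain ⟨s, t, rfl⟩ := h
  have hY : IsNode (s ++ (X ++ [c]) ++ t) (X ++ [c] ++ t) := .inl (.inl ⟨s, by simp⟩)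
  obtain ⟨W, hW, hWY⟩ := exists_isParent_toward hX hY ⟨[c] ++ t, by simp⟩
    (fun h => by simpa using congrArg List.length h)
  refine ⟨W, hW, List.prefix_of_prefix_length_le (List.prefix_append _ _) hWY ?_⟩
  have : X.length < W.length :=
    lt_of_le_of_ne hW.2.2.1.length_le fun h => hW.2.2.2.1 (hW.2.2.1.eq_of_length h)
  simpa using this

theorem isLongestPrefix_take {P : List α} {k : ℕ} (hk : P.take k <:+: T)
    (hk' : ∀ c, P[k]? = some c → ¬ P.take k ++ [c] <:+: T) :
    IsLongestPrefix T P (P.take k) := by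
  refine ⟨List.take_prefix _ _, hk, fun Q hQ hQT => ?_⟩
  by_contra! hlt
  have hQl := hQ.length_le
  have hkP : k < P.length := by
    rw [List.length_take] at hlt
    omega
  refine hk' P[k] (by simp [hkP]) (List.IsInfix.trans (List.IsPrefix.isInfix ?_) hQT)
  rw [← List.take_succ_eq_append_getElem hkP]
  refine List.prefix_of_prefix_length_le (List.take_prefix _ _) hQ ?_
  rw [List.length_take] at hlt ⊢
  omega

end Combinatorics

/-! ### An abstract matcher: correctness and number of steps. -/

section Matcher

variable {α : Type*}

/-- A state of the matcher: the number of symbols of the pattern that have been matched, the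
current node, and the stack of the edges that are being decompacted. An entry of the stack holds
the node at which the decompaction of an edge ends, and the lower end of the edge. -/
structure MatchState (α : Type*) where
  pos : ℕ
  node : List α
  stack : List (List α × List α)

/-- No decompaction ends at the node `X`. -/
def NotAtTarget (T X : List α) (s : List (List α × List α)) : Prop :=
  ∀ e ∈ s.head?, IsNode T e.1 ∧ X ≠ e.1

/-- A step of the matcher. -/
inductive MatchStep (T P : List α) : MatchState α → MatchState α → Prop where
  | advance {i : ℕ} {X Y : List α} {s : List (List α × List α)} {c : α}
      (hs : NotAtTarget T X s) (hc : P[i]? = some c) (hY : IsChild T X c Y)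
      (hp : ¬ IsPlus T Y) : MatchStep T P ⟨i, X, s⟩ ⟨i + 1, Y, s⟩
  | push {i h : ℕ} {X Y : List α} {s : List (List α × List α)} {c : α}
      (hs : NotAtTarget T X s) (hc : P[i]? = some c) (hY : IsChild T X c Y)
      (hp : IsPlus T Y) (hh : IsFastLinkHeight T X Y h) (hl : s.length < P.length) :
      MatchStep T P ⟨i, X, s⟩ ⟨i, slink^[h] X, (slink^[h] Y, Y) :: s⟩
  | pop {i : ℕ} {X Y : List α} {s : List (List α × List α)} (hX : IsNode T X) :
      MatchStep T P ⟨i, X, (X, Y) :: s⟩ ⟨i, Y, s⟩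

/-- A number of steps of the matcher. -/
inductive MatchSteps (T P : List α) : ℕ → MatchState α → MatchState α → Prop where
  | refl (x : MatchState α) : MatchSteps T P 0 x x
  | head {n : ℕ} {x y z : MatchState α} (h : MatchStep T P x y) (h' : MatchSteps T P n y z) :
      MatchSteps T P (n + 1) x z

theorem MatchSteps.trans {T P : List α} {m n : ℕ} {x y z : MatchState α}
    (h : MatchSteps T P m x y) (h' : MatchSteps T P n y z) : MatchSteps T P (m + n) x z := by
  induction h with
  | refl => simpa
  | head h _ ih =>
    rw [Nat.add_right_comm]
    exact .head h (ih h')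

theorem MatchSteps.single {T P : List α} {x y : MatchState α} (h : MatchStep T P x y) :
    MatchSteps T P 1 x y := .head h (.refl y)

/-- The matcher cannot extend the match. -/
def MatchState.IsFinal (T P : List α) (x : MatchState α) : Prop :=
  IsNode T x.node ∧ NotAtTarget T x.node x.stack ∧
    ∀ c Y, P[x.pos]? = some c → ¬ IsChild T x.node c Y

/-- When started at `X`, the matcher either reads the string `w` and arrives at `X ++ w`,
or it stops at the first symbol at which `w` and the rest of the pattern differ. -/
def Traverses (T P : List α) (d : ℕ) (X w : List α) (i : ℕ) (s : List (List α × List α)) :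
    Prop :=
  (w <+: P.drop i ∧ ∃ n, n + d ≤ 3 * w.length ∧
      MatchSteps T P n ⟨i, X, s⟩ ⟨i + w.length, X ++ w, s⟩) ∨
  ∃ r < w.length, w.take r <+: P.drop i ∧ ¬ w.take (r + 1) <+: P.drop i ∧
    ∃ n ≤ 4 * r + X.length, ∃ y : MatchState α,
      MatchSteps T P n ⟨i, X, s⟩ y ∧ y.pos = i + r ∧ y.IsFinal T P

variable {T P X w : List α} {i : ℕ} {s : List (List α × List α)}

/-- The slacks below three steps per symbol add up. The bound for failing runs composes as well:
`3|w|` steps for the first piece and `4r + |X| + |w|` for a failure in the second give `4(|w| + r) +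
|X|`. -/
theorem Traverses.append {d e : ℕ} {v : List α} (h : Traverses T P d X w i s)
    (h' : w <+: P.drop i → Traverses T P e (X ++ w) v (i + w.length) s) :
    Traverses T P (d + e) X (w ++ v) i s := by
  rcases h with ⟨hw, n, hn, hs⟩ | ⟨r, hr, h1, h2, n, hn, y, hy⟩
  · have key : ∀ u : List α, u <+: P.drop (i + w.length) ↔ w ++ u <+: P.drop i := by
      intro u
      obtain ⟨z, hz⟩ := hw
      rw [← hz, List.prefix_append_right_inj, ← List.drop_drop, ← hz, List.drop_left]
    rcases h' hw with ⟨hv, m, hm, hs'⟩ | ⟨r, hr, h1, h2, m, hm, y, hy, hpos, hf⟩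
    · left
      refine ⟨(key v).1 hv, n + m, ?_, ?_⟩
      · simp; omega
      · have := hs.trans hs'
        rwa [List.append_assoc, Nat.add_assoc, ← List.length_append] at this
    · right
      rw [key] at h1 h2
      refine ⟨w.length + r, by simp; omega, ?_, ?_, n + m, ?_, y, hs.trans hy, ?_, hf⟩
      · rwa [List.take_length_add_append]
      · rwa [Nat.add_assoc, List.take_length_add_append]
      · simp at hm; omega
      · omega
  · right
    refine ⟨r, by simp; omega, ?_, ?_, n, hn, y, hy⟩
    · rwa [List.take_append_of_le_length hr.le]
    · rwa [List.take_append_of_le_length hr]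

theorem Traverses.mono {d e : ℕ} (h : Traverses T P d X w i s) (hed : e ≤ d) :
    Traverses T P e X w i s := by
  rcases h with ⟨hw, n, hn, hs⟩ | h
  · exact .inl ⟨hw, n, by omega, hs⟩
  · exact .inr h

theorem cons_isPrefix_drop_iff {c : α} {v : List α} :
    c :: v <+: P.drop i ↔ P[i]? = some c ∧ v <+: P.drop (i + 1) := by
  by_cases hi : i < P.length
  · rw [List.drop_eq_getElem_cons hi, List.cons_prefix_cons, List.getElem?_eq_getElem hi,
      Option.some_inj, eq_comm]
  · rw [List.drop_eq_nil_of_le (by omega), List.getElem?_eq_none (by omega)]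
    simp

theorem IsParent.exists_append (h : IsParent T X w) :
    ∃ c v, w = X ++ c :: v ∧ IsChild T X c w := by
  obtain ⟨v, rfl⟩ := h.2.2.1
  rcases v with _ | ⟨c, v⟩
  · exact absurd (by simp) h.2.2.2.1
  · exact ⟨c, v, rfl, h, v, by simp⟩

/-- If edges are traversed, so are paths whose nodes other than the last are not branching. -/
theorem traverses_path {N : ℕ} {Y : List α}
    (hE : ∀ (X w : List α) (c : α) (i : ℕ) (s : List (List α × List α)),
      X.length + w.length ≤ N → IsChild T X c (X ++ w) → P[i]? = some c →
      NotAtTarget T X s → s.length + X.length ≤ i → Traverses T P 2 X w i s)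
    (X w : List α) (i : ℕ) (s : List (List α × List α)) (hN : X.length + w.length ≤ N)
    (hX : IsNode T X) (hXw : IsNode T (X ++ w)) (hw : w ≠ [])
    (h1 : ∀ j < w.length, ¬ IsType1 T (X ++ w.take j))
    (hi : s.length + 1 + X.length ≤ i) : Traverses T P 2 X w i ((X ++ w, Y) :: s) := by
  induction hn : w.length using Nat.strong_induction_on generalizing X w i with
  | _ n ih =>
  subst hn
  have hwpos := List.length_pos_iff.2 hw
  have hne : X ≠ X ++ w := by simpa using Ne.symm hw
  have hs : NotAtTarget T X ((X ++ w, Y) :: s) := by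
    intro e he
    obtain rfl : (X ++ w, Y) = e := by simpa using he
    exact ⟨hXw, hne⟩
  obtain ⟨Z, hZ, hZw⟩ := exists_isParent_toward hX hXw (List.prefix_append _ _) hne
  obtain ⟨c, v, rfl, hc⟩ := hZ.exists_append
  obtain ⟨u, rfl⟩ := (List.prefix_append_right_inj _).1 hZw
  have hXT : ¬ IsType1 T X := by simpa using h1 0 hwpos
  by_cases hPc : P[i]? = some c
  · have hv := hE X (c :: v) c i ((X ++ (c :: v ++ u), Y) :: s)
      (by rw [List.length_append] at hN; omega) hc hPc hs (by simpa using hi)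
    by_cases hu : u = []
    · subst hu
      simpa using hv
    · refine (hv.append (e := 2) fun _ => ?_).mono (by omega)
      have key := ih u.length (by simp) (X ++ c :: v) u (i + (c :: v).length)
        (by simp only [List.length_append] at hN ⊢; omega) hc.1.2.1 (by simpa using hXw) hu ?_
        (by simp only [List.length_append]; omega) rfl
      · simpa using key
      · intro j hj
        have := h1 ((c :: v).length + j) (by rw [List.length_append]; omega)
        rw [List.take_length_add_append] at this
        rwa [List.append_assoc]
  · right
    -- `X` is not of type 1, so `c` is its only continuation in `T`. If the pattern ends here or
    -- continues differently, there is no edge to follow.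
    refine ⟨0, hwpos, by simp, ?_, 0, by simp, ⟨i, X, _⟩, .refl _, rfl, hX, hs, ?_⟩
    · simp [cons_isPrefix_drop_iff, hPc]
    · rintro e V he hV
      have : c = e := eq_of_not_isType1 hXT (hc.2.isInfix.trans hc.1.2.1.isInfix)
        (hV.2.isInfix.trans hV.1.2.1.isInfix)
      exact hPc (this ▸ he)

/-- Induction on a bound for `|X| + |w|`: a fast link shortens `X` and keeps `w`. The inequality
`s.length + X.length ≤ i` is preserved, since a push costs depth and depth is regained only by
reading; it keeps the stack shorter than the pattern, as `push` demands. -/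
theorem traverses_edge (N : ℕ) : ∀ (X w : List α) (c : α) (i : ℕ) (s : List (List α × List α)),
    X.length + w.length ≤ N → IsChild T X c (X ++ w) → P[i]? = some c →
    NotAtTarget T X s → s.length + X.length ≤ i → Traverses T P 2 X w i s := by
  induction N with
  | zero =>
    intro X w c i s hN hc
    have := hc.2.length_le
    simp at this
    omega
  | succ N ih =>
  intro X w c i s hN hc hPc hs hi
  have hiP : i < P.length := (List.getElem?_eq_some_iff.1 hPc).1
  obtain ⟨v, rfl⟩ : ∃ v, w = c :: v := by
    obtain ⟨v, hv⟩ := (List.prefix_append_right_inj _).1 hc.2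
    exact ⟨v, by simpa using hv.symm⟩
  by_cases hv : v = []
  · subst hv
    -- A single step for a single symbol: the slack 2 is attained.
    refine .inl ⟨by simp [cons_isPrefix_drop_iff, hPc], 1, by simp, .single ?_⟩
    refine .advance hs hPc hc ?_
    rw [hc.1.isPlus_iff]
    simp
  have hl : X.length + 2 ≤ (X ++ c :: v).length := by
    have := List.length_pos_iff.2 hv
    simp
    omega
  obtain ⟨h, hh⟩ := exists_isFastLinkHeight (T := T) hl
  have hpos := hh.pos hc.1
  have hstep : MatchStep T P ⟨i, X, s⟩ _ :=
    .push hs hPc hc (hc.1.isPlus_iff.2 hl) hh (by omega)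
  have hnp := hh.2.1
  rw [iterate_slink, iterate_slink, List.drop_append_of_le_length hh.1] at hstep hnp
  have hX' : IsNode T (X.drop h) := hc.1.1.drop h
  have hY' : IsNode T (X.drop h ++ c :: v) := by
    have := hc.1.2.1.drop h
    rwa [List.drop_append_of_le_length hh.1] at this
  have hne : X.drop h ≠ X.drop h ++ c :: v := by simp
  have hs' : NotAtTarget T (X.drop h) ((X.drop h ++ c :: v, X ++ c :: v) :: s) := by
    intro e he
    obtain rfl : (X.drop h ++ c :: v, X ++ c :: v) = e := by simpa using he
    exact ⟨hY', hne⟩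
  have hlen : (X.drop h).length + h = X.length := by
    have := hh.1
    simp
    omega
  have inner : Traverses T P 4 (X.drop h) (c :: v) i
      ((X.drop h ++ c :: v, X ++ c :: v) :: s) := by
    obtain ⟨Z, hZ, hZw⟩ := exists_isParent_toward hX' hY' (List.prefix_append _ _) hne
    obtain ⟨c', v', rfl, hc'⟩ := hZ.exists_append
    obtain ⟨u, hu⟩ := (List.prefix_append_right_inj _).1 hZw
    obtain ⟨rfl, rfl⟩ : c' = c ∧ v' ++ u = v := by simpa using hu
    -- A fast link does not end in an edge, so at least two edges remain; each of the two pieces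
    -- contributes slack 2.
    have hu0 : u ≠ [] := by
      rintro rfl
      exact hnp (by simpa using hZ)
    simp only [List.length_cons, List.length_append] at hN
    have := (ih (X.drop h) (c' :: v') c' i
      ((X.drop h ++ c' :: (v' ++ u), X ++ c' :: (v' ++ u)) :: s)
      (by simp only [List.length_cons]; omega)
      hc' hPc hs' (by simp only [List.length_cons]; omega))
    refine this.append (v := u) (e := 2) fun _ => ?_
    have key := traverses_path (Y := X ++ c' :: (v' ++ u)) ih (X.drop h ++ c' :: v') u
      (i + (c' :: v').length) s (by simp only [List.length_cons, List.length_append]; omega)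
      hc'.1.2.1 (by simpa using hY') hu0 ?_
      (by simp only [List.length_cons, List.length_append]; omega)
    · simpa using key
    · intro j hj
      have := hh.not_isType1 (j := (c' :: v').length + j) hc.1 (by simp)
        (by simp only [List.length_cons, List.length_append]; omega)
      rw [← List.cons_append, List.take_length_add_append] at this
      rwa [List.append_assoc]
  rcases inner with ⟨hw, n, hn, hsteps⟩ | ⟨r, hr, h1, h2, n, hn, y, hy, hyf⟩
  -- The inner slack 4 pays for the push and the pop and leaves 2.
  · exact .inl ⟨hw, 1 + n + 1, by omega,
      ((MatchSteps.single hstep).trans hsteps).trans (.single (.pop hY'))⟩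
  -- The push is paid by the loss of depth, as `h > 0`.
  · exact .inr ⟨r, hr, h1, h2, 1 + n, by omega, y, (MatchSteps.single hstep).trans hy, hyf⟩

/-- From a node that is a prefix of the pattern, the matcher finds the longest prefix of the
pattern that occurs in `T`. -/
theorem exists_matchSteps_isFinal (X : List α) (hX : IsNode T X) (hXP : X <+: P) :
    ∃ k n y, n + 3 * X.length ≤ 4 * k ∧ k ≤ P.length ∧ MatchSteps T P n ⟨X.length, X, []⟩ y ∧
      y.pos = k ∧ y.IsFinal T P ∧ IsLongestPrefix T P (P.take k) := by
  induction hn : P.length - X.length using Nat.strong_induction_on generalizing X with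
  | _ n ih =>
  subst hn
  have hXl := hXP.length_le
  have hXt : P.take X.length = X := (List.prefix_iff_eq_take.1 hXP).symm
  have hs : NotAtTarget T X [] := by simp [NotAtTarget]
  by_cases hex : ∃ c Y, P[X.length]? = some c ∧ IsChild T X c Y
  · obtain ⟨c, Y, hPc, hc⟩ := hex
    obtain ⟨w, rfl⟩ := hc.1.2.2.1
    have hw : w ≠ [] := by
      rintro rfl
      exact hc.1.2.2.2.1 (by simp)
    have hwl := List.length_pos_iff.2 hw
    obtain ⟨Q, hQ⟩ := hXP
    have hdrop : P.drop X.length = Q := by rw [← hQ, List.drop_left]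
    rcases traverses_edge _ X w c X.length [] le_rfl hc hPc hs (by simp) with
      ⟨hwP, n, hn, hsteps⟩ | ⟨r, hr, h1, h2, n, hn, y, hy, hpos, hf⟩
    · rw [hdrop] at hwP
      have hXw : X ++ w <+: P := by rw [← hQ, List.prefix_append_right_inj]; exact hwP
      have hXwl := hXw.length_le
      rw [List.length_append] at hXwl
      obtain ⟨k, m, y, hm, hk, hsteps', hy⟩ := ih (P.length - (X ++ w).length)
        (by rw [List.length_append]; omega) (X ++ w) hc.1.2.1 hXw rfl
      rw [List.length_append] at hm hsteps'
      exact ⟨k, n + m, y, by omega, hk, hsteps.trans hsteps', hy⟩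
    -- The mismatch is not at the edge label, so the match ends strictly inside the edge, where no
    -- type-1 node lies.
    · have hr0 : 0 < r := by
        rcases Nat.eq_zero_or_pos r with rfl | h
        · obtain ⟨v, hv⟩ := (List.prefix_append_right_inj _).1 hc.2
          refine absurd ?_ h2
          rw [← hv]
          simp [cons_isPrefix_drop_iff, hPc]
        · exact h
      have hlen := h1.length_le
      rw [List.length_take, List.length_drop, min_eq_left hr.le] at hlen
      have htake : P.take (X.length + r) = X ++ w.take r := by
        rw [hdrop] at h1
        rw [← hQ, List.take_length_add_append, List.prefix_iff_eq_take.1 h1, List.length_take,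
          min_eq_left hr.le]
      refine ⟨X.length + r, n, y, by omega, by omega, hy, hpos, hf, ?_⟩
      have hpre : ∀ j, X ++ w.take j <+: X ++ w := fun j =>
        (List.prefix_append_right_inj _).2 (List.take_prefix _ _)
      refine isLongestPrefix_take ?_ ?_
      · rw [htake]
        exact (hpre r).isInfix.trans hc.1.2.1.isInfix
      · intro a ha haT
        rw [htake] at haT
        have hb := (hpre (r + 1)).isInfix.trans hc.1.2.1.isInfix
        rw [List.take_succ_eq_append_getElem hr, ← List.append_assoc] at hb
        have h1' : ¬ IsType1 T (X ++ w.take r) := by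
          intro h
          rcases hc.1.2.2.2.2 _ (.inl h) (List.prefix_append _ _) (hpre r) with h | h
          · have := congrArg List.length h
            rw [List.length_append, List.length_take] at this
            omega
          · have := congrArg List.length h
            rw [List.length_append, List.length_append, List.length_take] at this
            omega
        -- A longer match would have to continue with `w[r]`, the only continuation in `T`.
        have hab := eq_of_not_isType1 h1' haT hb
        apply h2
        obtain ⟨z, hz⟩ := h1
        have hl : (w.take r).length = r := by simp [hr.le]
        have hz' : [w[r]] <+: z := by
          have : P[X.length + r]? = z[0]? := by
            rw [← List.getElem?_drop, ← hz, List.getElem?_append_right (by omega), hl,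
              Nat.sub_self]
          rw [ha, hab] at this
          cases z with
          | nil => simp at this
          | cons => simpa using this
        rw [List.take_succ_eq_append_getElem hr, ← hz, List.prefix_append_right_inj]
        exact hz'
  · refine ⟨X.length, 0, ⟨X.length, X, []⟩, by omega, hXl, .refl _, rfl, ⟨hX, hs, ?_⟩, ?_⟩
    · exact fun c Y hc hY => hex ⟨c, Y, hc, hY⟩
    · refine isLongestPrefix_take (by rw [hXt]; exact hX.isInfix) ?_
      intro c hc hcT
      rw [hXt] at hcT
      obtain ⟨Y, hY⟩ := exists_isChild_of_append_isInfix hX hcT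
      exact hex ⟨c, Y, hc, hY⟩

end Matcher
end LST

/-! ### Step-counting rules for the machine. -/

namespace RAM

variable {α : Type*} [LinearOrder α]

theorem run_add (W : ℕ) (prog : Program) (s t : ℕ) (x : Config α) :
    run W prog (s + t) x = (run W prog s x).bind (run W prog t) := by
  induction s generalizing x with
  | zero => simp [run]
  | succ s ih =>
    rw [Nat.add_right_comm, run, run, Option.bind_assoc]
    exact congrArg _ (funext ih)

/-- Within `n` steps from `x` the program arrives without a fault at a configuration
that satisfies `Q`. -/
def Ensures (W : ℕ) (prog : Program) (n : ℕ) (x : Config α) (Q : Config α → Prop) : Prop :=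
  ∃ t ≤ n, ∃ y, run W prog t x = some y ∧ Q y

namespace Ensures

variable {W : ℕ} {prog : Program} {k n : ℕ} {x : Config α} {Q R : Config α → Prop} {pc : ℕ}
  {reg mem : ℕ → Word α}

theorem of_post (h : Q x) : Ensures W prog n x Q := ⟨0, Nat.zero_le _, x, rfl, h⟩

theorem trans (h : Ensures W prog k x R) (h' : ∀ y, R y → Ensures W prog n y Q) :
    Ensures W prog (k + n) x Q := by
  obtain ⟨s, hs, y, hy, hR⟩ := h
  obtain ⟨t, ht, z, hz, hQ⟩ := h' y hR
  exact ⟨s + t, by omega, z, by rw [run_add, hy]; exact hz, hQ⟩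

theorem mono (h : Ensures W prog k x R) (hkn : k ≤ n) (h' : ∀ y, R y → Q y) :
    Ensures W prog n x Q := by
  obtain ⟨s, hs, y, hy, hR⟩ := h
  exact ⟨s, hs.trans hkn, y, hy, h' y hR⟩

theorem head {i : Instr} {y : Config α} (hi : prog[x.pc]? = some i) (hy : i.exec W x = some y)
    (h : Ensures W prog n y Q) : Ensures W prog (n + 1) x Q := by
  obtain ⟨t, ht, z, hz, hQ⟩ := h
  refine ⟨t + 1, by omega, z, ?_, hQ⟩
  rw [run, step, hi, Option.bind_some, hy]
  exact hz

theorem const {d c : ℕ} (hi : prog[pc]? = some (.const d c)) (hc : c ≤ W)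
    (h : Ensures W prog n ⟨pc + 1, Function.update reg d (.num c), mem⟩ Q) :
    Ensures W prog (n + 1) ⟨pc, reg, mem⟩ Q :=
  head hi (by simp [Instr.exec, hc, Config.set]) h

theorem move {d s : ℕ} (w : Word α) (hi : prog[pc]? = some (.move d s)) (hw : reg s = w)
    (h : Ensures W prog n ⟨pc + 1, Function.update reg d w, mem⟩ Q) :
    Ensures W prog (n + 1) ⟨pc, reg, mem⟩ Q :=
  head hi (by simp [Instr.exec, hw, Config.set]) h

theorem add {d a b : ℕ} (u v : ℕ) (hi : prog[pc]? = some (.add d a b))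
    (hu : reg a = .num u) (hv : reg b = .num v) (huv : u + v ≤ W)
    (h : Ensures W prog n ⟨pc + 1, Function.update reg d (.num (u + v)), mem⟩ Q) :
    Ensures W prog (n + 1) ⟨pc, reg, mem⟩ Q :=
  head hi (by simp [Instr.exec, hu, hv, huv, Config.set]) h

theorem sub {d a b : ℕ} (u v : ℕ) (hi : prog[pc]? = some (.sub d a b))
    (hu : reg a = .num u) (hv : reg b = .num v)
    (h : Ensures W prog n ⟨pc + 1, Function.update reg d (.num (u - v)), mem⟩ Q) :
    Ensures W prog (n + 1) ⟨pc, reg, mem⟩ Q :=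
  head hi (by simp [Instr.exec, hu, hv, Config.set]) h

theorem half {d a : ℕ} (u : ℕ) (hi : prog[pc]? = some (.half d a)) (hu : reg a = .num u)
    (h : Ensures W prog n ⟨pc + 1, Function.update reg d (.num (u / 2)), mem⟩ Q) :
    Ensures W prog (n + 1) ⟨pc, reg, mem⟩ Q :=
  head hi (by simp [Instr.exec, hu, Config.set]) h

theorem load {d a : ℕ} (u : ℕ) (w : Word α) (hi : prog[pc]? = some (.load d a))
    (hu : reg a = .num u) (hw : mem u = w)
    (h : Ensures W prog n ⟨pc + 1, Function.update reg d w, mem⟩ Q) :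
    Ensures W prog (n + 1) ⟨pc, reg, mem⟩ Q :=
  head hi (by simp [Instr.exec, hu, hw, Config.set]) h

theorem store {a s : ℕ} (u : ℕ) (w : Word α) (hi : prog[pc]? = some (.store a s))
    (hu : reg a = .num u) (hw : reg s = w)
    (h : Ensures W prog n ⟨pc + 1, reg, Function.update mem u w⟩ Q) :
    Ensures W prog (n + 1) ⟨pc, reg, mem⟩ Q :=
  head hi (by simp [Instr.exec, hu, hw]) h

theorem jump {l : ℕ} (hi : prog[pc]? = some (.jump l))
    (h : Ensures W prog n ⟨l, reg, mem⟩ Q) : Ensures W prog (n + 1) ⟨pc, reg, mem⟩ Q :=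
  head hi (by simp [Instr.exec, Config.branch]) h

theorem jumpEq_pos {a b l : ℕ} (hi : prog[pc]? = some (.jumpEq a b l)) (hab : reg a = reg b)
    (h : Ensures W prog n ⟨l, reg, mem⟩ Q) : Ensures W prog (n + 1) ⟨pc, reg, mem⟩ Q :=
  head hi (by simp [Instr.exec, Config.branch, hab]) h

theorem jumpEq_neg {a b l : ℕ} (hi : prog[pc]? = some (.jumpEq a b l)) (hab : reg a ≠ reg b)
    (h : Ensures W prog n ⟨pc + 1, reg, mem⟩ Q) : Ensures W prog (n + 1) ⟨pc, reg, mem⟩ Q :=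
  head hi (by simp [Instr.exec, Config.branch, hab]) h

theorem jumpLt_sym_pos {a b l : ℕ} (c e : α) (hi : prog[pc]? = some (.jumpLt a b l))
    (ha : reg a = .sym c) (hb : reg b = .sym e) (hce : c < e)
    (h : Ensures W prog n ⟨l, reg, mem⟩ Q) : Ensures W prog (n + 1) ⟨pc, reg, mem⟩ Q :=
  head hi (by simp [Instr.exec, Config.branch, ha, hb, hce]) h

theorem jumpLt_sym_neg {a b l : ℕ} (c e : α) (hi : prog[pc]? = some (.jumpLt a b l))
    (ha : reg a = .sym c) (hb : reg b = .sym e) (hce : ¬ c < e)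
    (h : Ensures W prog n ⟨pc + 1, reg, mem⟩ Q) : Ensures W prog (n + 1) ⟨pc, reg, mem⟩ Q :=
  head hi (by simp [Instr.exec, Config.branch, ha, hb, hce]) h

end Ensures

end RAM

/-! ### The program simulates the matcher. -/

namespace LST

open RAM

/-- The matcher as a program. Registers: `0` the current node, `1` and `2` address and length of
the pattern, `3` the bottom of the stack, `4` the number of matched symbols, `5` the top of the
stack, `6` to `8` the constants 1, 2 and 3, `9` the next symbol of the pattern, `10` the table of
outgoing edges, `11` and `12` the bounds of a binary search, `14` an entry of that table,
`16` the child. -/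
def matcherProgram : Program :=
  [.const 4 0,
   .const 6 1,
   .const 7 2,
   .const 8 3,
   .move 5 3,
   .store 5 3,
   -- 6: the loop
   .load 15 5,
   .jumpEq 15 0 45,
   .jumpEq 4 2 49,
   .add 15 1 4,
   .load 9 15,
   .add 15 0 8,
   .load 10 15,
   .add 15 0 7,
   .load 12 15,
   .const 11 0,
   -- 16: binary search
   .jumpEq 11 12 49,
   .add 13 11 12,
   .half 13 13,
   .add 14 13 13,
   .add 14 14 14,
   .add 14 14 10,
   .load 15 14,
   .jumpEq 15 9 29,
   .jumpLt 15 9 27,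
   .move 12 13,
   .jump 16,
   .add 11 13 6,
   .jump 16,
   -- 29: a child is found
   .add 15 14 6,
   .load 16 15,
   .load 17 16,
   .jumpEq 17 6 36,
   .move 0 16,
   .add 4 4 6,
   .jump 6,
   -- 36: follow a fast link
   .add 15 14 7,
   .load 0 15,
   .add 15 14 8,
   .load 15 15,
   .add 5 5 7,
   .store 5 15,
   .add 15 5 6,
   .store 15 16,
   .jump 6,
   -- 45: return from a fast link
   .add 15 5 6,
   .load 0 15,
   .sub 5 5 7,
   .jump 6,
   -- 49: the end
   .move 0 4,
   .halt]

variable {α : Type*}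

/-- The stack of the matcher is stored from `free` on, above the sentinel `free`. -/
def StoresStack (L : Layout α) (free : ℕ) (mem : ℕ → Word α) : List (List α × List α) → Prop
  | [] => mem free = .num free
  | e :: s => mem (free + 2 * (s.length + 1)) = .num (L.addr e.1) ∧
      mem (free + 2 * (s.length + 1) + 1) = .num (L.addr e.2) ∧ StoresStack L free mem s

/-- The stored stack, sentinel included, lies below the next free slot, so a push does not disturb
it. -/
theorem StoresStack.congr {L : Layout α} {free : ℕ} {mem mem' : ℕ → Word α}
    {s : List (List α × List α)} (h : StoresStack L free mem s)
    (hmem : ∀ a < free + 2 * (s.length + 1), mem' a = mem a) : StoresStack L free mem' s := by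
  induction s with
  | nil =>
    rw [StoresStack, hmem _ (by simp)]
    exact h
  | cons e s ih =>
    rw [List.length_cons] at hmem
    refine ⟨?_, ?_, ih h.2.2 fun a ha => hmem a (by omega)⟩
    · rw [hmem _ (by omega)]
      exact h.1
    · rw [hmem _ (by omega)]
      exact h.2.1

/-- The memory `mem` agrees below `free` with `mem₀`, which holds the input, and the configuration
`x` at the head of the loop stands for the state `st` of the matcher. -/
structure Represents (P : List α) (L : Layout α) (free p : ℕ) (mem₀ : ℕ → Word α)
    (x : Config α) (st : MatchState α) : Prop where
  pc : x.pc = 6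
  node : x.reg 0 = .num (L.addr st.node)
  pattern : x.reg 1 = .num p
  length : x.reg 2 = .num P.length
  bottom : x.reg 3 = .num free
  pos : x.reg 4 = .num st.pos
  top : x.reg 5 = .num (free + 2 * st.stack.length)
  one : x.reg 6 = .num 1
  two : x.reg 7 = .num 2
  three : x.reg 8 = .num 3
  mem : ∀ a < free, x.mem a = mem₀ a
  stack : StoresStack L free x.mem st.stack
  depth : st.stack.length ≤ P.length

variable [LinearOrder α] {T P : List α} {L : Layout α} {free p W : ℕ} {mem₀ : ℕ → Word α}

theorem Stores.nodup_labels (hS : Stores T mem₀ free L) {X : List α} (hX : IsNode T X) :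
    ((L.kids X).map Prod.fst).Nodup :=
  List.pairwise_map.2 ((hS.kids_sorted X hX).imp ne_of_lt)

theorem Stores.child_unique (hS : Stores T mem₀ free L) {X Y V : List α} {c : α}
    (hY : IsChild T X c Y) (hV : IsChild T X c V) : Y = V :=
  congrArg Prod.snd (List.inj_on_of_nodup_map (hS.nodup_labels hY.1.1)
    ((hS.mem_kids X hY.1.1 c Y).2 hY) ((hS.mem_kids X hY.1.1 c V).2 hV) rfl)

theorem Stores.kids_length_le [Fintype α] (hS : Stores T mem₀ free L) {X : List α}
    (hX : IsNode T X) : (L.kids X).length ≤ Fintype.card α := by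
  simpa using (hS.nodup_labels hX).length_le_card

/-- This justifies the test at the head of the loop. With an empty stack the sentinel `free` is
compared, which exceeds the address of every node. -/
theorem StoresStack.exists_top {mem : ℕ → Word α} {X : List α} {s : List (List α × List α)}
    (h : StoresStack L free mem s) (hS : Stores T mem₀ free L) (hX : IsNode T X)
    (hs : NotAtTarget T X s) :
    ∃ t, mem (free + 2 * s.length) = .num t ∧ t ≠ L.addr X := by
  cases s with
  | nil =>
    have := hS.addr_lt X hX
    exact ⟨free, h, by omega⟩
  | cons e s =>
    have he := hs e (by simp)
    exact ⟨_, h.1, fun h => he.2 (hS.addr_inj _ _ hX he.1 h.symm)⟩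

/-- The binary search for the child with label `c`. -/
theorem ensures_search (hS : Stores T mem₀ free L) (hW : 100 * (free + 1) ≤ W) {X : List α}
    (hX : IsNode T X) (c : α) (n lo hi : ℕ) (reg mem : ℕ → Word α)
    (hmem : ∀ a < free, mem a = mem₀ a) (hn : hi - lo < 2 ^ n) (hlo : lo ≤ hi)
    (hhi : hi ≤ (L.kids X).length)
    (h1 : ∀ j < lo, ∀ e, (L.kids X)[j]? = some e → e.1 < c)
    (h2 : ∀ j, hi ≤ j → ∀ e, (L.kids X)[j]? = some e → c < e.1)
    (r6 : reg 6 = .num 1) (r9 : reg 9 = .sym c) (r10 : reg 10 = .num (L.table X))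
    (r11 : reg 11 = .num lo) (r12 : reg 12 = .num hi) :
    Ensures W matcherProgram (11 * n + 1) ⟨16, reg, mem⟩ fun y =>
      (∀ r ≤ 8, y.reg r = reg r) ∧ y.mem = mem ∧
      ((y.pc = 49 ∧ ∀ V, (c, V) ∉ L.kids X) ∨
        (y.pc = 29 ∧ ∃ j V, (L.kids X)[j]? = some (c, V) ∧
          y.reg 14 = .num (L.table X + 4 * j))) := by
  induction n generalizing lo hi reg with
  | zero =>
    obtain rfl : lo = hi := by simp at hn; omega
    refine .jumpEq_pos rfl (by rw [r11, r12]) (.of_post ⟨fun _ _ => rfl, rfl, .inl ⟨rfl, ?_⟩⟩)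
    intro V hV
    obtain ⟨j, hj⟩ := List.mem_iff_getElem?.1 hV
    rcases lt_or_ge j lo with h | h
    · exact lt_irrefl _ (h1 j h _ hj)
    · exact lt_irrefl _ (h2 j h _ hj)
  | succ n ih =>
    -- An empty range already satisfies the smaller bound.
    rcases hlo.eq_or_lt with rfl | hlt
    · exact (ih lo lo reg (by simp) le_rfl hhi h1 h2 r6 r9 r10 r11 r12).mono (by omega)
        fun _ h => h
    have hT := hS.table_le X hX
    obtain ⟨mid, hmid⟩ : ∃ mid, (lo + hi) / 2 = mid := ⟨_, rfl⟩
    have hlm : lo ≤ mid := by omega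
    have hmh : mid < hi := by omega
    rw [pow_succ] at hn
    obtain ⟨⟨e, V⟩, hV⟩ : ∃ e, (L.kids X)[mid]? = some e :=
      ⟨_, List.getElem?_eq_getElem (by omega)⟩
    have hlab := hS.edge_label X hX mid e V hV
    rw [← hmem _ (by omega)] at hlab
    have hsort : ∀ {j k : ℕ} {a b : α × List α}, j < k → (L.kids X)[j]? = some a →
        (L.kids X)[k]? = some b → a.1 < b.1 := by
      intro j k a b hjk ha hb
      obtain ⟨hj, rfl⟩ := List.getElem?_eq_some_iff.1 ha
      obtain ⟨hk, rfl⟩ := List.getElem?_eq_some_iff.1 hb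
      exact List.pairwise_iff_getElem.1 (hS.kids_sorted X hX) j k hj hk hjk
    refine .mono (k := 11 + (11 * n + 1)) (R := _) ?_ (by omega) fun _ h => h
    rw [Nat.add_comm 11]
    refine .jumpEq_neg rfl (by rw [r11, r12]; simpa using hlt.ne) ?_
    refine .add lo hi rfl (by simp [r11]) (by simp [r12]) (by omega) ?_
    refine .half (lo + hi) rfl (by simp) ?_
    rw [hmid]
    -- Table entries have four cells; two doublings replace the multiplication.
    refine .add mid mid rfl (by simp) (by simp) (by omega) ?_
    refine .add (mid + mid) (mid + mid) rfl (by simp) (by simp) (by omega) ?_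
    refine .add (mid + mid + (mid + mid)) (L.table X) rfl (by simp) (by simp [r10]) (by omega) ?_
    rw [show mid + mid + (mid + mid) + L.table X = L.table X + 4 * mid by ring]
    refine .load (L.table X + 4 * mid) (.sym e) rfl (by simp) hlab ?_
    by_cases hec : e = c
    · subst hec
      refine .jumpEq_pos rfl (by simp [r9]) (.of_post ⟨?_, rfl, .inr ⟨rfl, mid, V, hV, ?_⟩⟩)
      · intro r hr
        simp (disch := omega) [Function.update_of_ne]
      · simp
    refine .jumpEq_neg rfl (by simp [r9, hec]) ?_
    rcases lt_or_gt_of_ne hec with hlt' | hgt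
    · refine .jumpLt_sym_pos e c rfl (by simp) (by simp [r9]) hlt' ?_
      refine .add mid 1 rfl (by simp) (by simp [r6]) (by omega) ?_
      refine .jump rfl ?_
      refine (ih (mid + 1) hi _ (by omega) (by omega) hhi ?_ h2 (by simp [r6]) (by simp [r9])
        (by simp [r10]) (by simp) (by simp [r12])).mono le_rfl ?_
      · intro j hj a ha
        rcases (Nat.lt_succ_iff.1 hj).eq_or_lt with rfl | hj
        · rw [hV] at ha
          exact Option.some.inj ha ▸ hlt'
        · exact (hsort hj ha hV).trans hlt'
      · rintro y ⟨hy, hy'⟩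
        refine ⟨fun r hr => ?_, hy'⟩
        rw [hy r hr]
        simp (disch := omega) [Function.update_of_ne]
    · refine .jumpLt_sym_neg e c rfl (by simp) (by simp [r9]) hgt.not_gt ?_
      refine .move (.num mid) rfl (by simp) ?_
      refine .jump rfl ?_
      refine (ih lo mid _ (by omega) (by omega) (by omega) h1 ?_ (by simp [r6]) (by simp [r9])
        (by simp [r10]) (by simp [r11]) (by simp)).mono le_rfl ?_
      · intro j hj a ha
        rcases hj.eq_or_lt with rfl | hj
        · rw [hV] at ha
          exact Option.some.inj ha ▸ hgt
        · exact lt_trans hgt (hsort hj hV ha)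
      · rintro y ⟨hy, hy'⟩
        refine ⟨fun r hr => ?_, hy'⟩
        rw [hy r hr]
        simp (disch := omega) [Function.update_of_ne]

/-- At the head of the loop the matcher looks for the child with the next label. -/
theorem Represents.ensures_lookup [Fintype α] (hS : Stores T mem₀ free L)
    (hP : StoresString P mem₀ free p) (hW : 100 * (free + 1) ≤ W) {x : Config α}
    {st : MatchState α} (hx : Represents P L free p mem₀ x st) (hX : IsNode T st.node)
    (hs : NotAtTarget T st.node st.stack) {c : α} (hc : P[st.pos]? = some c) :
    Ensures W matcherProgram (11 * (Nat.log 2 (Fintype.card α) + 1) + 11) x fun y =>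
      (∀ r ≤ 8, y.reg r = x.reg r) ∧ y.mem = x.mem ∧
      ((y.pc = 49 ∧ ∀ V, (c, V) ∉ L.kids st.node) ∨
        (y.pc = 29 ∧ ∃ j V, (L.kids st.node)[j]? = some (c, V) ∧
          y.reg 14 = .num (L.table st.node + 4 * j))) := by
  obtain ⟨pc, reg, mem⟩ := x
  obtain ⟨i, X, s⟩ := st
  obtain ⟨rfl, r0, r1, r2, r3, r4, r5, r6, r7, r8, hmem, hst, hd⟩ := hx
  dsimp only at *
  have hiP : i < P.length := (List.getElem?_eq_some_iff.1 hc).1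
  have hPl := hP.1
  have haX := hS.addr_lt X hX
  have hT := hS.table_le X hX
  obtain ⟨t, ht, htX⟩ := hst.exists_top hS hX hs
  refine .load _ _ rfl r5 ht ?_
  refine .jumpEq_neg rfl (by simp [r0, htX]) ?_
  refine .jumpEq_neg rfl (by simp [r4, r2, hiP.ne]) ?_
  refine .add p i rfl (by simp [r1]) (by simp [r4]) (by omega) ?_
  refine .load (p + i) (.sym c) rfl (by simp) (by rw [hmem _ (by omega), hP.2 i c hc]) ?_
  refine .add (L.addr X) 3 rfl (by simp [r0]) (by simp [r8]) (by omega) ?_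
  refine .load (L.addr X + 3) _ rfl (by simp)
    (by rw [hmem _ (by omega), hS.table_addr X hX]) ?_
  refine .add (L.addr X) 2 rfl (by simp [r0]) (by simp [r7]) (by omega) ?_
  refine .load (L.addr X + 2) _ rfl (by simp)
    (by rw [hmem _ (by omega), hS.kids_length X hX]) ?_
  refine .const rfl (by omega) ?_
  refine (ensures_search hS hW hX c (Nat.log 2 (Fintype.card α) + 1) 0 (L.kids X).length _ mem
    hmem ?_ (by omega) le_rfl (by simp) ?_ (by simp [r6]) (by simp) (by simp) (by simp)
    (by simp)).mono (by omega) ?_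
  -- Labels in a table are distinct, so a range of at most `σ` entries is searched.
  · exact (hS.kids_length_le hX).trans_lt (Nat.lt_pow_succ_log_self one_lt_two _)
  · intro j hj e he
    rw [List.getElem?_eq_none hj] at he
    simp at he
  · rintro y ⟨hy, hy'⟩
    refine ⟨fun r hr => ?_, hy'⟩
    rw [hy r hr]
    simp (disch := omega) [Function.update_of_ne]

/-- The program from the head of the loop to a child that has been found. -/
theorem Represents.ensures_child [Fintype α] (hS : Stores T mem₀ free L)
    (hP : StoresString P mem₀ free p) (hW : 100 * (free + 1) ≤ W) {x : Config α}
    {st : MatchState α} (hx : Represents P L free p mem₀ x st)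
    (hs : NotAtTarget T st.node st.stack) {c : α} (hc : P[st.pos]? = some c) {Y : List α}
    (hY : IsChild T st.node c Y) :
    Ensures W matcherProgram (11 * (Nat.log 2 (Fintype.card α) + 1) + 11) x fun y =>
      Represents P L free p mem₀ { y with pc := 6 } st ∧ y.pc = 29 ∧
        ∃ j, (L.kids st.node)[j]? = some (c, Y) ∧
          y.reg 14 = .num (L.table st.node + 4 * j) := by
  refine (hx.ensures_lookup hS hP hW hY.1.1 hs hc).mono le_rfl ?_
  rintro ⟨pc, reg, mem⟩ ⟨hr, hm, h⟩
  dsimp only at hr hm h ⊢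
  subst hm
  rcases h with ⟨-, h⟩ | ⟨rfl, j, V, hj, h14⟩
  · exact absurd ((hS.mem_kids _ hY.1.1 c Y).2 hY) (h Y)
  · have hV : IsChild T st.node c V :=
      (hS.mem_kids _ hY.1.1 c V).1 (List.mem_of_getElem? hj)
    obtain rfl := hS.child_unique hY hV
    refine ⟨⟨rfl, ?_, ?_, ?_, ?_, ?_, ?_, ?_, ?_, ?_, hx.mem, hx.stack, hx.depth⟩, rfl, j, hj, h14⟩
    all_goals refine (hr _ (by omega)).trans ?_
    exacts [hx.node, hx.pattern, hx.length, hx.bottom, hx.pos, hx.top, hx.one, hx.two, hx.three]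

/-- The program simulates a step of the matcher. -/
theorem Represents.ensures_step [Fintype α] (hS : Stores T mem₀ free L)
    (hP : StoresString P mem₀ free p) (hW : 100 * (free + 1) ≤ W) {x : Config α}
    {st st' : MatchState α} (hx : Represents P L free p mem₀ x st) (h : MatchStep T P st st') :
    Ensures W matcherProgram (11 * (Nat.log 2 (Fintype.card α) + 1) + 30) x fun y =>
      Represents P L free p mem₀ y st' := by
  -- Besides the rounds of the search, a lookup takes 11 instructions, and the longest case, `push`,
  -- 13 more; 30 is generous.
  have hPl := hP.1
  cases h with
  | @advance i X Y s c hs hc hY hp =>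
    refine .mono (.trans (hx.ensures_child hS hP hW hs hc hY) ?_ (n := 7)) (by omega)
      fun _ h => h
    rintro ⟨pc, reg, mem⟩ ⟨hr, rfl, j, hj, h14⟩
    obtain ⟨-, r0, r1, r2, r3, r4, r5, r6, r7, r8, hmem, hst, hd⟩ := hr
    dsimp only at *
    have hjl := (List.getElem?_eq_some_iff.1 hj).1
    have hT := hS.table_le X hY.1.1
    have hiP : i < P.length := (List.getElem?_eq_some_iff.1 hc).1
    have haY := hS.addr_lt Y hY.1.2.1
    refine .add (L.table X + 4 * j) 1 rfl h14 r6 (by omega) ?_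
    refine .load (L.table X + 4 * j + 1) _ rfl (by simp)
      (by rw [hmem _ (by omega), hS.edge_target X hY.1.1 j c Y hj]) ?_
    refine .load (L.addr Y) _ rfl (by simp)
      (by rw [hmem _ (by omega), hS.plus_false Y hY.1.2.1 hp]) ?_
    refine .jumpEq_neg rfl (by simp [r6]) ?_
    refine .move _ rfl (by simp; rfl) ?_
    refine .add i 1 rfl (by simp [r4]) (by simp [r6]) (by omega) ?_
    refine .jump rfl (.of_post ⟨rfl, ?_, ?_, ?_, ?_, ?_, ?_, ?_, ?_, ?_, hmem, hst, hd⟩) <;>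
      simp [r1, r2, r3, r5, r6, r7, r8]
  | @push i h X Y s c hs hc hY hp hh hl =>
    refine .mono (.trans (hx.ensures_child hS hP hW hs hc hY) ?_ (n := 13)) (by omega)
      fun _ h => h
    rintro ⟨pc, reg, mem⟩ ⟨hr, rfl, j, hj, h14⟩
    obtain ⟨-, r0, r1, r2, r3, r4, r5, r6, r7, r8, hmem, hst, hd⟩ := hr
    dsimp only at *
    have hjl := (List.getElem?_eq_some_iff.1 hj).1
    have hT := hS.table_le X hY.1.1
    have haY := hS.addr_lt Y hY.1.2.1
    obtain ⟨hf1, hf2⟩ := hS.fast_link X hY.1.1 j c Y hj h hh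
    refine .add (L.table X + 4 * j) 1 rfl h14 r6 (by omega) ?_
    refine .load (L.table X + 4 * j + 1) _ rfl (by simp)
      (by rw [hmem _ (by omega), hS.edge_target X hY.1.1 j c Y hj]) ?_
    refine .load (L.addr Y) _ rfl (by simp)
      (by rw [hmem _ (by omega), hS.plus_true Y hY.1.2.1 hp]) ?_
    refine .jumpEq_pos rfl (by simp [r6]) ?_
    refine .add (L.table X + 4 * j) 2 rfl (by simp [h14]) (by simp [r7]) (by omega) ?_
    refine .load (L.table X + 4 * j + 2) _ rfl (by simp) (by rw [hmem _ (by omega), hf1]) ?_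
    refine .add (L.table X + 4 * j) 3 rfl (by simp [h14]) (by simp [r8]) (by omega) ?_
    refine .load (L.table X + 4 * j + 3) _ rfl (by simp) (by rw [hmem _ (by omega), hf2]) ?_
    refine .add (free + 2 * s.length) 2 rfl (by simp [r5]) (by simp [r7]) (by omega) ?_
    refine .store (free + 2 * s.length + 2) (.num (L.addr (slink^[h] Y))) rfl (by simp)
      (by simp) ?_
    refine .add (free + 2 * s.length + 2) 1 rfl (by simp) (by simp [r6]) (by omega) ?_
    refine .store (free + 2 * s.length + 2 + 1) (.num (L.addr Y)) rfl (by simp) (by simp) ?_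
    refine .jump rfl (.of_post ⟨rfl, ?_, ?_, ?_, ?_, ?_, ?_, ?_, ?_, ?_, ?_,
      ⟨?_, ?_, ?_⟩, hl⟩)
    · simp
    · simp [r1]
    · simp [r2]
    · simp [r3]
    · simp [r4]
    · simp [mul_add, add_assoc]
    · simp [r6]
    · simp [r7]
    · simp [r8]
    · intro a ha
      simp (disch := omega) [Function.update_of_ne, hmem a ha]
    · simp [mul_add, add_assoc]
    · simp [mul_add, add_assoc]
    · refine hst.congr fun a ha => ?_
      simp (disch := omega) [Function.update_of_ne]
  | @pop i X Y s hX =>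
    obtain ⟨pc, reg, mem⟩ := x
    obtain ⟨rfl, r0, r1, r2, r3, r4, r5, r6, r7, r8, hmem, ⟨ht, hv, hst⟩, hd⟩ := hx
    dsimp only [List.length_cons] at *
    refine .mono (k := 6) (R := _) ?_ (by omega) fun _ h => h
    refine .load _ _ rfl r5 ht ?_
    refine .jumpEq_pos rfl (by simp [r0]) ?_
    refine .add (free + 2 * (s.length + 1)) 1 rfl (by simp [r5]) (by simp [r6]) (by omega) ?_
    refine .load (free + 2 * (s.length + 1) + 1) _ rfl (by simp) hv ?_
    refine .sub (free + 2 * (s.length + 1)) 2 rfl (by simp [r5]) (by simp [r7]) ?_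
    refine .jump rfl (.of_post ⟨rfl, ?_, ?_, ?_, ?_, ?_, ?_, ?_, ?_, ?_, hmem, hst,
      Nat.le_of_succ_le hd⟩)
    all_goals simp [r1, r2, r3, r4, r6, r7, r8]
    omega

theorem Represents.ensures_steps [Fintype α] (hS : Stores T mem₀ free L)
    (hP : StoresString P mem₀ free p) (hW : 100 * (free + 1) ≤ W) {x : Config α}
    {st st' : MatchState α} {n : ℕ} (hx : Represents P L free p mem₀ x st)
    (h : MatchSteps T P n st st') :
    Ensures W matcherProgram (n * (11 * (Nat.log 2 (Fintype.card α) + 1) + 30)) x fun y =>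
      Represents P L free p mem₀ y st' := by
  induction h generalizing x with
  | refl => exact .of_post hx
  | head h _ ih =>
    rw [Nat.succ_mul, Nat.add_comm]
    exact (hx.ensures_step hS hP hW h).trans fun y hy => ih hy

/-- In a final state the program stops with the number of matched symbols. -/
theorem Represents.ensures_halt [Fintype α] (hS : Stores T mem₀ free L)
    (hP : StoresString P mem₀ free p) (hW : 100 * (free + 1) ≤ W) {x : Config α}
    {st : MatchState α} (hx : Represents P L free p mem₀ x st) (hst : st.IsFinal T P)
    (hpos : st.pos ≤ P.length) :
    Ensures W matcherProgram (11 * (Nat.log 2 (Fintype.card α) + 1) + 30) x fun y =>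
      matcherProgram[y.pc]? = some .halt ∧ y.reg 0 = .num st.pos := by
  have hdone : ∀ y : Config α, y.pc = 49 ∧ y.reg 4 = x.reg 4 →
      Ensures W matcherProgram 1 y fun y =>
        matcherProgram[y.pc]? = some .halt ∧ y.reg 0 = .num st.pos := by
    rintro ⟨pc, reg, mem⟩ ⟨rfl, h4⟩
    exact .move (.num st.pos) rfl (h4.trans hx.pos) (.of_post ⟨rfl, by simp⟩)
  -- The program ends because the pattern is used up, or because the search finds no child.
  rcases hpos.eq_or_lt with heq | hlt
  · refine .mono (.trans (k := 3) (R := fun y => y.pc = 49 ∧ y.reg 4 = x.reg 4) ?_ hdone)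
      (by omega) fun _ h => h
    obtain ⟨pc, reg, mem⟩ := x
    obtain ⟨i, X, s⟩ := st
    obtain ⟨hX, hs, -⟩ := hst
    obtain ⟨rfl, r0, r1, r2, r3, r4, r5, r6, r7, r8, hmem, hst, hd⟩ := hx
    dsimp only at *
    have haX := hS.addr_lt X hX
    obtain ⟨t, ht, htX⟩ := hst.exists_top hS hX hs
    refine .load _ _ rfl r5 ht ?_
    refine .jumpEq_neg rfl (by simp [r0, htX]) ?_
    exact .jumpEq_pos rfl (by simp [r4, r2, heq]) (.of_post ⟨rfl, by simp⟩)
  · obtain ⟨c, hc⟩ : ∃ c, P[st.pos]? = some c := ⟨_, List.getElem?_eq_getElem hlt⟩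
    refine .mono (.trans (hx.ensures_lookup hS hP hW hst.1 hst.2.1 hc) ?_ (n := 1))
      (by omega) fun _ h => h
    rintro y ⟨hr, -, ⟨hpc, -⟩ | ⟨-, j, V, hj, -⟩⟩
    · exact hdone y ⟨hpc, hr 4 (by omega)⟩
    · exact absurd ((hS.mem_kids _ hst.1 c V).1 (List.mem_of_getElem? hj)) (hst.2.2 c V hc)

end LST

theorem mainTheorem4 :
    ∃ (prog : RAM.Program) (C : ℕ),
      ∀ (α : Type*) [Fintype α] [LinearOrder α] (T P : List α)
        (L : LST.Layout α) (free p W : ℕ) (x : RAM.Config α),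
        LST.IsMatchingInput T P L free p x →
        C * (free + 1) ≤ W →
        ∃ P' : List α, LST.IsLongestPrefix T P P' ∧
          RAM.HaltsWithin W prog x
            (C * ((P'.length + 1) * (Nat.log 2 (Fintype.card α) + 1))) P'.length := by
  -- With `l = log₂ σ`, a step costs at most `41(l + 1)` instructions. There are at most four steps
  -- per matched symbol, `164(l + 1)`; the initialisation and the last lookup add at most `47(l +
  -- 1)`.
  refine ⟨LST.matcherProgram, 200, ?_⟩
  intro α _ _ T P L free p W x hin hW
  obtain ⟨hS, hP, hpc, r0, r1, r2, r3⟩ := hin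
  obtain ⟨k, n, st, hn, hk, hsteps, rfl, hf, hlong⟩ :=
    LST.exists_matchSteps_isFinal (P := P) [] (LST.isNode_nil (T := T)) List.nil_prefix
  have hinit : RAM.Ensures W LST.matcherProgram 6 x fun y =>
      LST.Represents P L free p x.mem y ⟨0, [], []⟩ := by
    obtain ⟨pc, reg, mem⟩ := x
    dsimp only at *
    subst hpc
    refine .const rfl (by omega) (.const rfl (by omega) (.const rfl (by omega)
      (.const rfl (by omega) ?_)))
    refine .move (.num free) rfl (by simp [r3]) ?_
    refine .store free (.num free) rfl (by simp) (by simp [r3]) ?_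
    refine .of_post ⟨rfl, ?_, ?_, ?_, ?_, ?_, ?_, ?_, ?_, ?_, ?_, ?_, Nat.zero_le _⟩
    all_goals simp [r0, r1, r2, r3, LST.StoresStack]
    intro a ha
    rw [Function.update_of_ne ha.ne]
  refine ⟨P.take st.pos, hlong, ?_⟩
  rw [List.length_take, min_eq_left hk]
  refine RAM.Ensures.mono (hinit.trans fun y hy =>
    (hy.ensures_steps hS hP (by omega) hsteps).trans fun z hz =>
      hz.ensures_halt hS hP (by omega) hf hk) ?_ fun _ h => h
  simp only [List.length_nil, mul_zero, add_zero] at hn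
  generalize Nat.log 2 (Fintype.card α) = l
  have := Nat.mul_le_mul_right (11 * (l + 1) + 30) hn
  nlinarith [Nat.zero_le (st.pos * l)]
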